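/- Let $\mathbb{F}_q$ be a finite field with $q$ elements, $K=\mathbb{F}_{q^n}$ an extension of it with $q^n$ elements, $d\ge 0$ an integer and $V=K^d$. Let $\Gamma L(d,K)$ be the group of all additive bijections $T:V\to V$ for which there is an automorphism $\sigma$ of $K$ (an accompanying automorphism of $T$) with $T(\alpha v)=\alpha^{\sigma}T(v)$ for all $\alpha\in K$, $v\in V$, and let $GL(d,K)$ be its subgroup of $K$-linear bijections. Call $T\in\Gamma L(d,K)$ irreducible if the only $K$-subspaces $W$ of $V$ with $T(W)\subseteq W$ are $\{0\}$ and $V$. Let $\sigma$ be a generator of $\mathrm{Gal}(K/\mathbb{F}_q)$ and let $T,U$ be irreducible elements of $\Gamma L(d,K)$ which both have accompanying automorphism $\sigma$; thus $T$ and $U$ are $\mathbb{F}_q$-linear. Let $m_T,m_U\in\mathbb{F}_q[y]$ be the minimal polynomials over $\mathbb{F}_q$ of $T^n$ and $U^n$. Then: 1. $T$ and $U$ are conjugate by an element of $GL(d,K)$ if and only if $m_T=m_U$. 2. $T$ and $U$ are conjugate in $\Gamma L(d,K)$ if and only if there is $\rho\in\mathrm{Aut}(\mathbb{F}_q)$ with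 $m_U=m_T^{\rho}$, where $m_T^{\rho}$ is obtained from $m_T$ by applying $\rho$ to its coefficients. -/

import Mathlib

/-- `T` is a bijective semilinear transformation of `K ^ d` with accompanying
automorphism `σ`. -/
def IsSemilinearWith {K : Type*} [Field K] {d : ℕ} (σ : K ≃+* K)
    (T : Equiv.Perm (Fin d → K)) : Prop :=
  (∀ v w : Fin d → K, T (v + w) = T v + T w) ∧
    ∀ (a : K) (v : Fin d → K), T (a • v) = σ a • T v

/-- The general semilinear group `ΓL(d, K)`: the group, under composition, of the bijections
of `K ^ d` that are semilinear for some automorphism of `K`. -/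
def GammaL (d : ℕ) (K : Type*) [Field K] : Subgroup (Equiv.Perm (Fin d → K)) where
  carrier := {T | ∃ σ : K ≃+* K, IsSemilinearWith σ T}
  one_mem' := ⟨RingEquiv.refl K, fun _ _ => rfl, fun _ _ => rfl⟩
  mul_mem' := by
    rintro S T ⟨σ, hS, hS'⟩ ⟨τ, hT, hT'⟩
    refine ⟨τ.trans σ, fun v w => ?_, fun a v => ?_⟩
    · change S (T (v + w)) = S (T v) + S (T w)
      rw [hT, hS]
    · change S (T (a • v)) = σ (τ a) • S (T v)
      rw [hT', hS']
  inv_mem' := by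
    rintro T ⟨σ, hT, hT'⟩
    refine ⟨σ.symm, fun v w => ?_, fun a v => ?_⟩
    · change T.symm (v + w) = T.symm v + T.symm w
      rw [Equiv.symm_apply_eq, hT, Equiv.apply_symm_apply, Equiv.apply_symm_apply]
    · change T.symm (a • v) = σ.symm a • T.symm v
      rw [Equiv.symm_apply_eq, hT', RingEquiv.apply_symm_apply, Equiv.apply_symm_apply]

namespace GammaL

/-- `σ` is an automorphism accompanying `T`. -/
def HasAut {d : ℕ} {K : Type*} [Field K] (T : GammaL d K) (σ : K ≃+* K) : Prop :=
  IsSemilinearWith σ (T : Equiv.Perm (Fin d → K))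

/-- The only `T`-invariant `K`-subspaces of `K ^ d` are `0` and `K ^ d`. -/
def IsIrreducible {d : ℕ} {K : Type*} [Field K] (T : GammaL d K) : Prop :=
  ∀ W : Submodule K (Fin d → K),
    (∀ w ∈ W, (T : Equiv.Perm (Fin d → K)) w ∈ W) → W = ⊥ ∨ W = ⊤

/-- The inclusion of `GL(d, K)`, the group of invertible `K`-linear maps of `K ^ d`,
in `ΓL(d, K)`. -/
def ofGL {d : ℕ} {K : Type*} [Field K] :
    ((Fin d → K) ≃ₗ[K] (Fin d → K)) →* GammaL d K where
  toFun φ := ⟨φ.toEquiv, RingEquiv.refl K, φ.map_add, φ.map_smul⟩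
  map_one' := rfl
  map_mul' _ _ := rfl

/-- `T` and `U` are conjugate by an element of `GL(d, K)`. -/
def IsGLConj {d : ℕ} {K : Type*} [Field K] (T U : GammaL d K) : Prop :=
  ∃ φ : (Fin d → K) ≃ₗ[K] (Fin d → K), ofGL φ * T * (ofGL φ)⁻¹ = U

/-- If the automorphism `σ` accompanying `T` fixes the subfield `F`, then `T` is an
`F`-linear endomorphism of `K ^ d`. -/
def toEnd {d : ℕ} {F K : Type*} [Field F] [Field K] [Algebra F K] (T : GammaL d K)
    {σ : K ≃ₐ[F] K} (h : HasAut T σ.toRingEquiv) : Module.End F (Fin d → K) where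
  toFun := (T : Equiv.Perm (Fin d → K))
  map_add' := h.1
  map_smul' c v := by
    have key := h.2 (algebraMap F K c) v
    have hc : σ.toRingEquiv (algebraMap F K c) = algebraMap F K c := σ.commutes c
    rw [hc, algebraMap_smul, algebraMap_smul] at key
    exact key

end GammaL

open Polynomial

/-! Since `σ` has order `n`, `T ^ n` is `K`-linear. It commutes with `T`, so the coefficients of its
minimal polynomial over `K` are fixed by `σ` and lie in `F`: this polynomial is `m_T`.

If `m_T = m_U = m`, apply the divided difference of `m` to a map of rank one. The result `φ`
satisfies `U ^ n φ = φ T ^ n`, and minimality of `m` allows a choice with `φ ≠ 0`. Averaging, `∑ σ ^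
i (a) U ^ i φ T ^ (n - i)` is `K`-linear and intertwines `T` and `U`; Dedekind independence of
characters gives an `a` for which it is nonzero. Its kernel is `T`-invariant, hence zero by
irreducibility, so it is an element of `GL(d, K)`.

For conjugacy in `ΓL(d, K)`, extend `ρ` to `K` and conjugate `T` by the coordinatewise action: `σ`
is kept and `ρ` is applied to `m_T`, which reduces to the linear case. The converses hold because
semilinear conjugation transports minimal polynomials. -/

/-! ### Intertwiners by divided differences -/

theorem mul_sum_sub_sum_mul {R : Type*} [Ring R] (A B ψ : R) (j : ℕ) :
    B * (∑ i ∈ Finset.range j, B ^ i * ψ * A ^ (j - 1 - i)) -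
      (∑ i ∈ Finset.range j, B ^ i * ψ * A ^ (j - 1 - i)) * A = B ^ j * ψ - ψ * A ^ j := by
  rw [Finset.mul_sum, Finset.sum_mul, ← Finset.sum_sub_distrib]
  have h : ∀ i ∈ Finset.range j, B * (B ^ i * ψ * A ^ (j - 1 - i)) -
      B ^ i * ψ * A ^ (j - 1 - i) * A =
      B ^ (i + 1) * ψ * A ^ (j - (i + 1)) - B ^ i * ψ * A ^ (j - i) := by
    intro i hi
    have hi := Finset.mem_range.1 hi
    rw [show j - i = j - 1 - i + 1 by omega, show j - (i + 1) = j - 1 - i by omega,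
      pow_succ' B, pow_succ A]
    simp only [mul_assoc]
  rw [Finset.sum_congr rfl h, Finset.sum_range_sub (fun i => B ^ i * ψ * A ^ (j - i))]
  simp

/-- Two endomorphisms of a nonzero space that are annihilated by the same monic polynomial `m`,
where no nonzero polynomial of smaller degree annihilates `B`, have a nonzero intertwiner: the
divided difference of `m` applied to a suitable map of rank one. -/
theorem exists_ne_zero_intertwiner {K V : Type*} [Field K] [AddCommGroup V] [Module K V]
    [Nontrivial V] (A B : Module.End K V) (m : K[X]) (hm : m.Monic)
    (hA : aeval A m = 0) (hB : aeval B m = 0)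
    (hmin : ∀ g : K[X], g ≠ 0 → g.degree < m.degree → aeval B g ≠ 0) :
    ∃ φ : Module.End K V, φ ≠ 0 ∧ B * φ = φ * A := by
  obtain ⟨w, hw⟩ := exists_ne (0 : V)
  obtain ⟨f, hf⟩ := Module.Projective.exists_dual_ne_zero K hw
  obtain ⟨k, hk⟩ : ∃ k, m.natDegree = k + 1 := by
    refine Nat.exists_eq_succ_of_ne_zero fun h => ?_
    rw [hm.natDegree_eq_zero.1 h, map_one] at hA
    exact one_ne_zero hA
  -- For `ψ = f(·) v`, the divided difference sends `w` to `g(B) v`. The polynomial `g` has degree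
  -- `deg m - 1` and leading coefficient `f w ≠ 0`, so `g(B) ≠ 0` and a suitable `v` exists.
  set c : ℕ → ℕ → K := fun j i => m.coeff j * f ((A ^ (j - 1 - i)) w) with hc
  set g : K[X] := ∑ j ∈ Finset.range (k + 2), ∑ i ∈ Finset.range j, C (c j i) * X ^ i with hg
  have hcoeff : ∀ N, g.coeff N = ∑ j ∈ Finset.range (k + 2),
      if N < j then c j N else 0 := by
    intro N
    rw [hg, finsetSum_coeff]
    refine Finset.sum_congr rfl fun j _ => ?_
    rw [finsetSum_coeff]
    simp only [coeff_C_mul_X_pow, Finset.sum_ite_eq, Finset.mem_range]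
  have hgk : g.coeff k = f w := by
    rw [hcoeff, Finset.sum_range_succ, Finset.sum_eq_zero, zero_add, if_pos (Nat.lt_succ_self k)]
    · have : m.coeff (k + 1) = 1 := hk ▸ hm.coeff_natDegree
      simp [hc, this]
    · intro j hj
      exact if_neg (by have := Finset.mem_range.1 hj; omega)
  have hg0 : g ≠ 0 := fun h => hf (by rw [← hgk, h, coeff_zero])
  have hgd : g.degree < m.degree := by
    rw [degree_eq_natDegree hm.ne_zero, hk, degree_lt_iff_coeff_zero]
    intro N hN
    rw [hcoeff]
    exact Finset.sum_eq_zero fun j hj => if_neg (by have := Finset.mem_range.1 hj; omega)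
  obtain ⟨v, hv⟩ : ∃ v, aeval B g v ≠ 0 := by
    by_contra! h
    exact hmin g hg0 hgd (LinearMap.ext h)
  set ψ : Module.End K V := f.smulRight v with hψ
  refine ⟨∑ j ∈ Finset.range (k + 2), m.coeff j •
    ∑ i ∈ Finset.range j, B ^ i * ψ * A ^ (j - 1 - i), fun h => hv ?_, ?_⟩
  · rw [← LinearMap.zero_apply (σ₁₂ := RingHom.id K) w, ← h, hg]
    simp only [map_sum, map_mul, aeval_C, map_pow, aeval_X, LinearMap.sum_apply,
      LinearMap.smul_apply, Finset.smul_sum]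
    refine Finset.sum_congr rfl fun j _ => Finset.sum_congr rfl fun i _ => ?_
    simp only [hc, hψ, map_mul, Module.algebraMap_end_apply, Module.End.mul_apply,
      LinearMap.smulRight_apply, map_smul]
    exact smul_comm _ _ _
  · rw [← sub_eq_zero, Finset.mul_sum, Finset.sum_mul, ← Finset.sum_sub_distrib]
    simp only [mul_smul_comm, smul_mul_assoc, ← smul_sub, mul_sum_sub_sum_mul]
    have hsum : ∀ D : Module.End K V, aeval D m =
        ∑ j ∈ Finset.range (k + 2), m.coeff j • D ^ j := fun D => by
      rw [aeval_eq_sum_range, hk]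
    have h1 : ∑ j ∈ Finset.range (k + 2), m.coeff j • (B ^ j * ψ) = 0 := by
      simp only [← smul_mul_assoc, ← Finset.sum_mul, ← hsum, hB, zero_mul]
    have h2 : ∑ j ∈ Finset.range (k + 2), m.coeff j • (ψ * A ^ j) = 0 := by
      simp only [← mul_smul_comm, ← Finset.mul_sum, ← hsum, hA, mul_zero]
    simp only [smul_sub, Finset.sum_sub_distrib, h1, h2, sub_zero]

/-! ### Minimal polynomials and semilinear maps -/

section Semilinear

variable {R R' V V' : Type*} [CommRing R] [CommRing R'] [AddCommGroup V] [AddCommGroup V']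
  [Module R V] [Module R' V'] {τ : R →+* R'}

/-- A semilinear map that intertwines `A` and `A'` intertwines `p(A)` and `p^τ(A')`. -/
theorem LinearMap.semilinear_aeval_apply (S : V →ₛₗ[τ] V') (A : Module.End R V)
    (A' : Module.End R' V') (h : ∀ v, S (A v) = A' (S v)) (p : R[X]) (v : V) :
    S (aeval A p v) = aeval A' (p.map τ) (S v) := by
  have hpow : ∀ (i : ℕ) (v : V), S ((A ^ i) v) = (A' ^ i) (S v) := by
    intro i
    induction i with
    | zero => intro v; rfl
    | succ i ih => intro v; rw [pow_succ, pow_succ, Module.End.mul_apply, ih, h]; rfl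
  induction p using Polynomial.induction_on' with
  | add p q hp hq => simp [hp, hq]
  | monomial i a =>
    simp [aeval_monomial, Module.algebraMap_end_apply, hpow, Module.End.mul_apply]

end Semilinear

/-- Semilinear conjugation applies the field automorphism to the minimal polynomial. -/
theorem minpoly_map_of_semilinear {F F' V V' : Type*} [Field F] [Field F'] [AddCommGroup V]
    [AddCommGroup V'] [Module F V] [Module F' V'] [FiniteDimensional F V]
    (ρ : F ≃+* F') (S : V →ₛₗ[(ρ : F →+* F')] V') (hS : Function.Bijective S)
    (A : Module.End F V) (A' : Module.End F' V') (h : ∀ v, S (A v) = A' (S v)) :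
    (minpoly F A).map (ρ : F →+* F') = minpoly F' A' := by
  have hint : IsIntegral F A := Algebra.IsIntegral.isIntegral A
  refine minpoly.unique F' A' ((minpoly.monic hint).map _) ?_ fun q hq hq0 => ?_
  · refine LinearMap.ext fun w => ?_
    obtain ⟨v, rfl⟩ := hS.2 w
    rw [← S.semilinear_aeval_apply A A' h, minpoly.aeval, LinearMap.zero_apply, map_zero,
      LinearMap.zero_apply]
  · have hmap : (q.map (ρ.symm : F' →+* F)).map (ρ : F →+* F') = q := by
      rw [Polynomial.map_map]
      convert q.map_id
      ext x
      simp
    have hz : aeval A (q.map (ρ.symm : F' →+* F)) = 0 := by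
      refine LinearMap.ext fun v => hS.1 ?_
      rw [S.semilinear_aeval_apply A A' h, hmap, hq0]
      simp
    have := minpoly.min F A (hq.map (ρ.symm : F' →+* F)) hz
    rwa [degree_map] at this ⊢

/-- If `A` commutes with a bijective semilinear map whose automorphism generates the Galois group
of `K / F`, then its minimal polynomial has coefficients in `F`. -/
theorem minpoly_eq_map_of_semilinear_commute {F K V : Type*} [Field F] [Field K] [Algebra F K]
    [FiniteDimensional F K] [IsGalois F K] [AddCommGroup V] [Module F V] [Module K V]
    [IsScalarTower F K V] [FiniteDimensional K V] [FiniteDimensional F V]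
    (σ : K ≃ₐ[F] K) (hσ : Subgroup.zpowers σ = ⊤)
    (S : V →ₛₗ[(σ.toRingEquiv : K →+* K)] V) (hS : Function.Bijective S)
    (A : Module.End K V) (h : ∀ v, S (A v) = A (S v))
    (a : Module.End F V) (ha : ∀ v, a v = A v) :
    minpoly K A = (minpoly F a).map (algebraMap F K) := by
  have hfix := minpoly_map_of_semilinear σ.toRingEquiv S hS A A h
  have hcoeff : ∀ i, σ ((minpoly K A).coeff i) = (minpoly K A).coeff i := by
    intro i
    conv_rhs => rw [← hfix, coeff_map]
    rfl
  have hint : IsIntegral K A := Algebra.IsIntegral.isIntegral A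
  have hlift : minpoly K A ∈ lifts (algebraMap F K) := by
    rw [lifts_iff_coeff_lifts]
    intro i
    rw [IsGalois.mem_range_algebraMap_iff_fixed]
    intro g
    have hg : g ∈ Subgroup.zpowers σ := hσ ▸ Subgroup.mem_top g
    have hle : Subgroup.zpowers σ ≤ MulAction.stabilizer (K ≃ₐ[F] K) ((minpoly K A).coeff i) := by
      rw [Subgroup.zpowers_le]
      exact hcoeff i
    exact hle hg
  obtain ⟨p, hp, hdeg, hmonic⟩ := lifts_and_degree_eq_and_monic hlift (minpoly.monic hint)
  -- The identity, viewed as semilinear along `F → K`, carries polynomial identities between `a` and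
  -- `A`.
  let I : V →ₛₗ[algebraMap F K] V :=
    { toFun := id, map_add' := fun _ _ => rfl, map_smul' := fun c v => by simp }
  have hI : ∀ v, I (a v) = A (I v) := ha
  rw [← hp]
  congr 1
  refine minpoly.unique F a hmonic ?_ fun q hq hq0 => ?_
  · refine LinearMap.ext fun v => ?_
    change I (aeval a p v) = 0
    rw [I.semilinear_aeval_apply a A hI, hp, minpoly.aeval, LinearMap.zero_apply]
  · have : aeval A (q.map (algebraMap F K)) = 0 := by
      refine LinearMap.ext fun v => ?_
      change aeval A (q.map (algebraMap F K)) (I v) = 0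
      rw [← I.semilinear_aeval_apply a A hI, hq0, LinearMap.zero_apply, map_zero]
    have := minpoly.min K A (hq.map _) this
    rwa [degree_map, ← hdeg] at this

/-! ### Averaging over the powers of `σ` -/

theorem pow_apply_smul_of_semilinear {F K V : Type*} [Field F] [Field K] [Algebra F K]
    [AddCommGroup V] [Module F V] [Module K V] {σ : K ≃ₐ[F] K} {t : Module.End F V}
    (ht : ∀ (a : K) (v : V), t (a • v) = σ a • t v) (i : ℕ) (a : K) (v : V) :
    (t ^ i) (a • v) = (σ ^ i) a • (t ^ i) v := by
  induction i with
  | zero => rfl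
  | succ i ih => simp only [pow_succ', Module.End.mul_apply, ih, ht, AlgEquiv.mul_apply]

/-- A nonzero intertwiner of the `n`-th powers of two `σ`-semilinear maps, where `n` is the order
of `σ`, can be averaged to a nonzero intertwiner of the maps themselves. -/
theorem exists_ne_zero_intertwiner_of_pow {F K V : Type*} [Field F] [Field K] [Algebra F K]
    [AddCommGroup V] [Module F V] [Module K V] {n : ℕ} (hn : 0 < n)
    {σ : K ≃ₐ[F] K} (hσ : orderOf σ = n) {t u : Module.End F V}
    (ht : ∀ (a : K) (v : V), t (a • v) = σ a • t v)
    (hu : ∀ (a : K) (v : V), u (a • v) = σ a • u v) (hsurj : Function.Surjective t)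
    (φ : Module.End K V) (hφ : φ ≠ 0) (h : ∀ v, (u ^ n) (φ v) = φ ((t ^ n) v)) :
    ∃ ψ : Module.End K V, ψ ≠ 0 ∧ ∀ v, u (ψ v) = ψ (t v) := by
  have hσn : σ ^ n = 1 := hσ ▸ pow_orderOf_eq_one σ
  -- The exponent `n - i` replaces `-i`: no inverse of `t` is needed, and each term is linear
  -- because `σ ^ i σ ^ (n - i) = 1`.
  let ψ : K → Module.End K V := fun a =>
    { toFun := fun v => ∑ i ∈ Finset.range n, (σ ^ i) a • (u ^ i) (φ ((t ^ (n - i)) v))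
      map_add' := fun v w => by simp only [map_add, smul_add, Finset.sum_add_distrib]
      map_smul' := fun c v => by
        rw [RingHom.id_apply, Finset.smul_sum]
        refine Finset.sum_congr rfl fun i hi => ?_
        rw [pow_apply_smul_of_semilinear ht, map_smul, pow_apply_smul_of_semilinear hu,
          ← AlgEquiv.mul_apply, ← pow_add, Nat.add_sub_cancel' (Finset.mem_range.1 hi).le, hσn,
          AlgEquiv.one_apply, smul_comm] }
  have hψ : ∀ a v, ψ a v = ∑ i ∈ Finset.range n, (σ ^ i) a • (u ^ i) (φ ((t ^ (n - i)) v)) :=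
    fun _ _ => rfl
  obtain ⟨a, ha⟩ : ∃ a, ψ a ≠ 0 := by
    by_contra! hzero
    obtain ⟨w, hw⟩ : ∃ w, φ w ≠ 0 := by
      by_contra! h0
      exact hφ (LinearMap.ext h0)
    obtain ⟨v, rfl⟩ : ∃ v, (t ^ n) v = w := by
      rw [Module.End.coe_pow]
      exact hsurj.iterate n w
    obtain ⟨f, hf⟩ := Module.Projective.exists_dual_ne_zero K hw
    -- If every `ψ a` vanished, applying `f` at `v` would give a linear relation among the distinct
    -- characters `σ ^ i`, whose coefficient at `i = 0` is `f (φ (t ^ n v)) ≠ 0`.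
    have hinj : Function.Injective fun i : Fin n => ((σ ^ (i : ℕ) : K ≃ₐ[F] K) : K →* K) := by
      intro i j hij
      have : σ ^ (i : ℕ) = σ ^ (j : ℕ) := AlgEquiv.ext fun x => DFunLike.congr_fun hij x
      exact Fin.ext (pow_injOn_Iio_orderOf (by simp [hσ]) (by simp [hσ]) this)
    have hli := (linearIndependent_monoidHom K K).comp _ hinj
    rw [Fintype.linearIndependent_iff] at hli
    refine hf ?_
    have key := hli (fun i => f ((u ^ (i : ℕ)) (φ ((t ^ (n - (i : ℕ))) v)))) ?_ ⟨0, hn⟩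
    · simpa using key
    · funext a
      have := congrArg f (LinearMap.congr_fun (hzero a) v)
      rw [hψ, map_sum, Finset.sum_range] at this
      simpa [mul_comm] using this
  refine ⟨ψ a, ha, fun v => ?_⟩
  rw [hψ, hψ, map_sum, ← sub_eq_zero]
  have h1 : ∀ i ∈ Finset.range n, u ((σ ^ i) a • (u ^ i) (φ ((t ^ (n - i)) v))) =
      (σ ^ (i + 1)) a • (u ^ (i + 1)) (φ ((t ^ (n + 1 - (i + 1))) v)) := by
    intro i _
    rw [hu, pow_succ' σ, pow_succ' u, Nat.add_sub_add_right]
    rfl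
  have h2 : ∀ i ∈ Finset.range n, (σ ^ i) a • (u ^ i) (φ ((t ^ (n - i)) (t v))) =
      (σ ^ i) a • (u ^ i) (φ ((t ^ (n + 1 - i)) v)) := by
    intro i hi
    rw [Nat.sub_add_comm (Finset.mem_range.1 hi).le, pow_succ]
    rfl
  -- The difference telescopes to the boundary terms `u ^ n φ t` and `φ t ^ (n + 1)`, both with
  -- coefficient `a`; they agree by `h`.
  rw [Finset.sum_congr rfl h1, Finset.sum_congr rfl h2, ← Finset.sum_sub_distrib,
    Finset.sum_range_sub (fun i => (σ ^ i) a • (u ^ i) (φ ((t ^ (n + 1 - i)) v))), hσn,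
    Nat.add_sub_cancel_left, h, pow_zero, pow_zero, Nat.sub_zero, pow_one, pow_succ, sub_eq_zero]
  rfl

/-! ### Automorphisms of finite fields -/

/-- A ring isomorphism of fields of characteristic `p`, as an algebra isomorphism over the prime
field. -/
def RingEquiv.toAlgEquivZMod (p : ℕ) {K L : Type*} [Field K] [Field L] [Algebra (ZMod p) K]
    [Algebra (ZMod p) L] (τ : K ≃+* L) : K ≃ₐ[ZMod p] L :=
  AlgEquiv.ofRingEquiv (f := τ) fun c => RingHom.congr_fun
    (Subsingleton.elim ((τ : K →+* L).comp (algebraMap (ZMod p) K)) (algebraMap (ZMod p) L)) c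

/-- Automorphisms of a finite field commute. -/
theorem RingEquiv.apply_comm_of_finite_field {K : Type*} [Field K] [Finite K] (σ τ : K ≃+* K)
    (x : K) : σ (τ x) = τ (σ x) := by
  obtain ⟨p, _⟩ := CharP.exists K
  have := Fact.mk (CharP.char_is_prime K p)
  let := ZMod.algebra K p
  exact DFunLike.congr_fun (mul_comm' (σ.toAlgEquivZMod p) (τ.toAlgEquivZMod p)) x

/-- Every automorphism of a finite field `K` restricts to any subfield. -/
theorem RingEquiv.exists_restrict_of_finite_field {F K : Type*} [Field F] [Field K] [Finite K]
    [Finite F] [Algebra F K] (τ : K ≃+* K) :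
    ∃ ρ : F ≃+* F, ∀ x, τ (algebraMap F K x) = algebraMap F K (ρ x) := by
  obtain ⟨p, _⟩ := CharP.exists F
  have := Fact.mk (CharP.char_is_prime F p)
  have : CharP K p := charP_of_injective_algebraMap (algebraMap F K).injective p
  let := ZMod.algebra K p
  let := ZMod.algebra F p
  have : IsScalarTower (ZMod p) F K := IsScalarTower.of_algebraMap_eq' (Subsingleton.elim _ _)
  exact ⟨((τ.toAlgEquivZMod p).restrictNormal F).toRingEquiv,
    fun x => ((τ.toAlgEquivZMod p).restrictNormal_commutes F x).symm⟩

/-- Every automorphism of a subfield of a finite field `K` extends to `K`. -/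
theorem RingEquiv.exists_extend_of_finite_field {F K : Type*} [Field F] [Field K] [Finite K]
    [Finite F] [Algebra F K] (ρ : F ≃+* F) :
    ∃ τ : K ≃+* K, ∀ x, τ (algebraMap F K x) = algebraMap F K (ρ x) := by
  obtain ⟨p, _⟩ := CharP.exists F
  have := Fact.mk (CharP.char_is_prime F p)
  have : CharP K p := charP_of_injective_algebraMap (algebraMap F K).injective p
  let := ZMod.algebra K p
  let := ZMod.algebra F p
  have : IsScalarTower (ZMod p) F K := IsScalarTower.of_algebraMap_eq' (Subsingleton.elim _ _)
  exact ⟨((ρ.toAlgEquivZMod p).liftNormal K).toRingEquiv,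
    fun x => (ρ.toAlgEquivZMod p).liftNormal_commutes K x⟩

/-! ### Conjugacy in the semilinear group -/

namespace GammaL

theorem isGLConj_iff {K : Type*} [Field K] {d : ℕ} (T U : GammaL d K) :
    IsGLConj T U ↔ ∃ φ : (Fin d → K) ≃ₗ[K] (Fin d → K), ∀ v,
      φ ((T : Equiv.Perm (Fin d → K)) v) = (U : Equiv.Perm (Fin d → K)) (φ v) := by
  refine exists_congr fun φ => ?_
  rw [mul_inv_eq_iff_eq_mul, Subtype.ext_iff, Equiv.ext_iff]
  rfl

theorem isConj_iff_forall {K : Type*} [Field K] {d : ℕ} (T U : GammaL d K) :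
    IsConj T U ↔ ∃ S : GammaL d K, ∀ v,
      (S : Equiv.Perm (Fin d → K)) ((T : Equiv.Perm (Fin d → K)) v) =
        (U : Equiv.Perm (Fin d → K)) ((S : Equiv.Perm (Fin d → K)) v) := by
  rw [isConj_iff]
  refine exists_congr fun S => ?_
  rw [mul_inv_eq_iff_eq_mul, Subtype.ext_iff, Equiv.ext_iff]
  rfl

theorem IsGLConj.isConj {K : Type*} [Field K] {d : ℕ} {T U : GammaL d K} (h : IsGLConj T U) :
    IsConj T U :=
  let ⟨φ, hφ⟩ := h
  isConj_iff.2 ⟨ofGL φ, hφ⟩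

variable {F K : Type*} [Field F] [Field K] [Finite K] [Algebra F K] {n d : ℕ}
  {σ : K ≃ₐ[F] K} {T U : GammaL d K}

/-- Conjugation by a semilinear bijection whose automorphism restricts to `ρ` applies `ρ` to the
minimal polynomials of the powers. -/
theorem minpoly_toEnd_pow_map (hT : HasAut T σ.toRingEquiv) (hU : HasAut U σ.toRingEquiv)
    (S : Equiv.Perm (Fin d → K)) (τ : K ≃+* K) (hS : IsSemilinearWith τ S) (ρ : F ≃+* F)
    (hρ : ∀ x, τ (algebraMap F K x) = algebraMap F K (ρ x))
    (h : ∀ v, S ((T : Equiv.Perm (Fin d → K)) v) = (U : Equiv.Perm (Fin d → K)) (S v)) (n : ℕ) :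
    (minpoly F (toEnd T hT ^ n)).map (ρ : F →+* F) = minpoly F (toEnd U hU ^ n) := by
  refine minpoly_map_of_semilinear ρ
    { toFun := S
      map_add' := hS.1
      map_smul' := fun c v => by
        rw [← algebraMap_smul K c v, hS.2, hρ, algebraMap_smul]
        rfl } S.bijective _ _ fun v => ?_
  change S ((toEnd T hT ^ n) v) = (toEnd U hU ^ n) (S v)
  rw [Module.End.coe_pow, Module.End.coe_pow]
  exact (Function.Semiconj.iterate_right (f := S) h n) v

/-- The `n`-th power of `T`, as a `K`-linear map, when `σ ^ n = 1`. -/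
def powLinear (hT : HasAut T σ.toRingEquiv) (hn : σ ^ n = 1) : Module.End K (Fin d → K) :=
  { toFun := fun v => (toEnd T hT ^ n) v
    map_add' := map_add _
    map_smul' := fun c v => by
      rw [pow_apply_smul_of_semilinear (fun a v => hT.2 a v), hn]
      rfl }

theorem minpoly_powLinear (hσ : Subgroup.zpowers σ = ⊤) (hT : HasAut T σ.toRingEquiv)
    (hn : σ ^ n = 1) : minpoly K (powLinear hT hn) =
      (minpoly F (toEnd T hT ^ n)).map (algebraMap F K) := by
  refine minpoly_eq_map_of_semilinear_commute σ hσ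
    { toFun := (T : Equiv.Perm (Fin d → K)), map_add' := hT.1, map_smul' := hT.2 }
    (Equiv.bijective _) _ (fun v => ?_) _ fun v => rfl
  change (toEnd T hT * toEnd T hT ^ n) v = (toEnd T hT ^ n * toEnd T hT) v
  rw [← pow_succ, ← pow_succ']

theorem isGLConj_of_minpoly_eq (hn : 0 < n) (hord : orderOf σ = n)
    (hσ : Subgroup.zpowers σ = ⊤)
    (hT : HasAut T σ.toRingEquiv) (hU : HasAut U σ.toRingEquiv) (hTirr : IsIrreducible T)
    (h : minpoly F (toEnd T hT ^ n) = minpoly F (toEnd U hU ^ n)) : IsGLConj T U := by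
  rw [isGLConj_iff]
  cases subsingleton_or_nontrivial (Fin d → K) with
  | inl _ => exact ⟨LinearEquiv.refl K _, fun v => Subsingleton.elim _ _⟩
  | inr _ =>
    have hσn : σ ^ n = 1 := hord ▸ pow_orderOf_eq_one σ
    have hmin : minpoly K (powLinear hT hσn) = minpoly K (powLinear hU hσn) := by
      rw [minpoly_powLinear hσ, minpoly_powLinear hσ, h]
    obtain ⟨φ, hφ0, hφ⟩ := exists_ne_zero_intertwiner (powLinear hT hσn) (powLinear hU hσn)
      (minpoly K (powLinear hU hσn)) (minpoly.monic (Algebra.IsIntegral.isIntegral _))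
      (hmin ▸ minpoly.aeval _ _) (minpoly.aeval _ _)
      fun g hg hlt h0 => not_lt_of_ge (minpoly.degree_le_of_ne_zero _ _ hg h0) hlt
    obtain ⟨ψ, hψ0, hψ⟩ := exists_ne_zero_intertwiner_of_pow hn hord
      (t := toEnd T hT) (u := toEnd U hU) hT.2 hU.2 (Equiv.surjective _) φ hφ0
      fun v => LinearMap.congr_fun hφ v
    have hker : LinearMap.ker ψ = ⊥ := by
      refine (hTirr (LinearMap.ker ψ) fun w hw => ?_).resolve_right fun htop =>
        hψ0 (LinearMap.ker_eq_top.1 htop)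
      rw [LinearMap.mem_ker] at hw ⊢
      exact (hψ w).symm.trans (by rw [hw, map_zero])
    exact ⟨LinearEquiv.ofInjectiveEndo ψ (LinearMap.ker_eq_bot.1 hker), fun v => (hψ v).symm⟩

/-- Conjugation by the coordinatewise action of an automorphism of `K`. -/
theorem exists_conj_of_ringEquiv (hT : HasAut T σ.toRingEquiv) (hTirr : IsIrreducible T)
    (τ : K ≃+* K) :
    ∃ T' S : GammaL d K, HasAut S τ ∧ HasAut T' σ.toRingEquiv ∧ IsIrreducible T' ∧
      ∀ v, (S : Equiv.Perm (Fin d → K)) ((T : Equiv.Perm (Fin d → K)) v) =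
        (T' : Equiv.Perm (Fin d → K)) ((S : Equiv.Perm (Fin d → K)) v) := by
  have hs : IsSemilinearWith τ (Equiv.piCongrRight fun _ : Fin d => τ.toEquiv) :=
    ⟨fun v w => funext fun i => map_add τ _ _, fun a v => funext fun i => map_mul τ _ _⟩
  let S : GammaL d K := ⟨_, τ, hs⟩
  have hS : HasAut S τ := hs
  let s : Equiv.Perm (Fin d → K) := S.1
  let t : Equiv.Perm (Fin d → K) := T.1
  have hinv : ∀ v, ((S * T * S⁻¹ : GammaL d K) : Equiv.Perm (Fin d → K)) (s v) = s (t v) := by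
    intro v
    change s (t (s.symm (s v))) = _
    rw [s.symm_apply_apply]
  refine ⟨S * T * S⁻¹, S, hS, ⟨fun v w => ?_, fun a v => ?_⟩, fun W hW => ?_, fun v =>
    (hinv v).symm⟩
  · obtain ⟨v, rfl⟩ := s.surjective v
    obtain ⟨w, rfl⟩ := s.surjective w
    rw [← hS.1, hinv, hinv, hinv, hT.1, hS.1]
  · obtain ⟨v, rfl⟩ := s.surjective v
    obtain ⟨a, rfl⟩ := τ.surjective a
    -- The conjugate has automorphism `τ σ τ⁻¹`, which is `σ` because `Aut(K)` is abelian.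
    rw [← hS.2, hinv, hinv, hT.2, hS.2, RingEquiv.apply_comm_of_finite_field]
  · have h0 : s 0 = 0 := by simpa using hS.2 0 0
    let W' : Submodule K (Fin d → K) :=
      { carrier := {v | s v ∈ W}
        add_mem' := fun {v w} hv hw => by
          rw [Set.mem_ofPred_eq, hS.1]
          exact W.add_mem hv hw
        zero_mem' := by
          rw [Set.mem_ofPred_eq, h0]
          exact W.zero_mem
        smul_mem' := fun c v hv => by
          rw [Set.mem_ofPred_eq, hS.2]
          exact W.smul_mem _ hv }
    have hmem : ∀ v, v ∈ W' ↔ s v ∈ W := fun _ => Iff.rfl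
    refine (hTirr W' fun w hw => ?_).imp (fun h => ?_) fun h => ?_
    · rw [hmem] at hw ⊢
      rw [← hinv]
      exact hW _ hw
    · rw [eq_bot_iff]
      intro v hv
      obtain ⟨v, rfl⟩ := s.surjective v
      have : v ∈ W' := hv
      rw [h, Submodule.mem_bot] at this
      rw [this, h0]
      exact Submodule.zero_mem _
    · rw [eq_top_iff]
      intro v _
      obtain ⟨v, rfl⟩ := s.surjective v
      rw [← hmem, h]
      exact Submodule.mem_top

end GammaL

theorem mainTheorem8 {F K : Type*} [Field F] [Field K] [Finite F] [Finite K] [Algebra F K]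
    (q n d : ℕ) (hF : Nat.card F = q) (hK : Nat.card K = q ^ n)
    (σ : K ≃ₐ[F] K) (hσ : Subgroup.zpowers σ = ⊤)
    (T U : GammaL d K)
    (hT : GammaL.HasAut T σ.toRingEquiv) (hU : GammaL.HasAut U σ.toRingEquiv)
    (hTirr : GammaL.IsIrreducible T) (hUirr : GammaL.IsIrreducible U) :
    (GammaL.IsGLConj T U ↔
      minpoly F (GammaL.toEnd T hT ^ n) = minpoly F (GammaL.toEnd U hU ^ n)) ∧
    (IsConj T U ↔ ∃ ρ : F ≃+* F,
      (minpoly F (GammaL.toEnd T hT ^ n)).map (ρ : F →+* F) =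
        minpoly F (GammaL.toEnd U hU ^ n)) := by
  have hrank : Module.finrank F K = n := by
    have h := Module.natCard_eq_pow_finrank (K := F) (V := K)
    rw [hK, hF] at h
    exact (Nat.pow_right_injective (hF ▸ Finite.one_lt_card) h).symm
  have hn : 0 < n := hrank ▸ Module.finrank_pos
  have hord : orderOf σ = n := by
    rw [orderOf_eq_card_of_zpowers_eq_top hσ, IsGalois.card_aut_eq_finrank, hrank]
  refine ⟨⟨fun h => ?_, GammaL.isGLConj_of_minpoly_eq hn hord hσ hT hU hTirr⟩,
    fun h => ?_, fun ⟨ρ, hρ⟩ => ?_⟩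
  · obtain ⟨φ, hφ⟩ := (GammaL.isGLConj_iff T U).1 h
    have := GammaL.minpoly_toEnd_pow_map hT hU φ.toEquiv (RingEquiv.refl K)
      ⟨φ.map_add, φ.map_smul⟩ (RingEquiv.refl F) (fun _ => rfl) hφ n
    exact (Polynomial.map_id (p := minpoly F (GammaL.toEnd T hT ^ n))).symm.trans this
  · obtain ⟨⟨S, τ, hS⟩, hSTU⟩ := (GammaL.isConj_iff_forall T U).1 h
    obtain ⟨ρ, hρ⟩ := τ.exists_restrict_of_finite_field (F := F)
    exact ⟨ρ, GammaL.minpoly_toEnd_pow_map hT hU S τ hS ρ hρ hSTU n⟩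
  · obtain ⟨τ, hτ⟩ := ρ.exists_extend_of_finite_field (K := K)
    obtain ⟨T', S, hS, hT', hT'irr, hST⟩ := GammaL.exists_conj_of_ringEquiv hT hTirr τ
    refine ((GammaL.isConj_iff_forall T T').2 ⟨S, hST⟩).trans
      (GammaL.isGLConj_of_minpoly_eq hn hord hσ hT' hU hT'irr ?_).isConj
    rw [← hρ, GammaL.minpoly_toEnd_pow_map hT hT' S τ hS ρ hτ hST n]
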